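/- Let $X=(X_t)_{t\ge 0}$ be a real-valued stochastic process on a probability space $(\Omega,\mathcal F,\mathbb P)$ (each $X_t$ is $\mathcal F$-measurable) whose paths $t\mapsto X_t(\omega)$ are, for almost every $\omega$, right-continuous on $[0,\infty)$. For a real random variable $Y$ let $\operatorname{supp}(Y)$ be the smallest closed set $F\subseteq\mathbb R$ with $\mathbb P(Y\in F)=1$, and let $$\operatorname{MSupp}(X)=\{(t,x)\in[0,\infty)\times\mathbb R : x\in\operatorname{supp}(X_t)\}$$ be the marginal support of $X$. Then, with probability $1$, $$\{(t,X_t): t\in[0,\infty)\}\subseteq\operatorname{MSupp}(X).$$ -/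

import Mathlib

open MeasureTheory Set
open scoped NNReal

noncomputable section

/-- The support of a real random variable `Y` under `P`: the support of its law. -/
def rvSupport {Ω : Type*} [MeasurableSpace Ω] (P : Measure Ω) (Y : Ω → ℝ) : Set ℝ :=
  (P.map Y).support

/-- The support of a real random variable is the smallest closed set that contains it with
probability one. -/
theorem rvSupport_isLeast {Ω : Type*} [MeasurableSpace Ω] (P : Measure Ω)
    [IsProbabilityMeasure P] (Y : Ω → ℝ) (hY : Measurable Y) :
    IsLeast {F : Set ℝ | IsClosed F ∧ P {ω | Y ω ∈ F} = 1} (rvSupport P Y) := by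
  have key : ∀ F : Set ℝ, IsClosed F → (P {ω | Y ω ∈ F} = 1 ↔ F ∈ ae (P.map Y)) := by
    intro F hF
    have := Measure.isProbabilityMeasure_map (μ := P) hY.aemeasurable
    rw [mem_ae_iff_prob_eq_one hF.measurableSet, Measure.map_apply hY hF.measurableSet]
    rfl
  refine ⟨⟨Measure.isClosed_support, ?_⟩, ?_⟩
  · exact (key _ Measure.isClosed_support).2 Measure.support_mem_ae
  · rintro F ⟨hF, h⟩
    exact Measure.support_subset_of_isClosed hF ((key F hF).1 h)

/-- The marginal support `{(t, x) : x ∈ supp (X_t)}` of a real process indexed by `[0, ∞)`. -/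
def marginalSupport {Ω : Type*} [MeasurableSpace Ω] (P : Measure Ω) (X : ℝ≥0 → Ω → ℝ) :
    Set (ℝ≥0 × ℝ) :=
  {p | p.2 ∈ rvSupport P (X p.1)}

/-- A path on `[0, ∞)` that is right-continuous at every time. -/
def RightContinuousPath (x : ℝ≥0 → ℝ) : Prop :=
  ∀ t : ℝ≥0, ContinuousWithinAt x (Ici t) t

end

open scoped Topology

/-! Fix a basic open `U`. The times whose law misses `U` may be uncountable, but a countable subset
`D` approaches each of them from the right. Almost surely the path avoids `U` on `D`, hence at all
these times by right-continuity. A countable basis finishes. -/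

/-- Hereditary separability for the topology of right neighbourhoods: every set `T` of times has a
countable subset from which each point of `T` can be approached from the right. -/
theorem exists_countable_subset_mem_closure_inter_Ici (T : Set ℝ≥0) :
    ∃ D ⊆ T, D.Countable ∧ ∀ t ∈ T, t ∈ closure (D ∩ Ici t) := by
  obtain ⟨E, hET, hEc, hTE⟩ :=
    (TopologicalSpace.IsSeparable.of_separableSpace T).exists_countable_dense_subset
  -- Points of `T` isolated from the right need not be limits of `E` from that side; they are
  -- countably many, so all are added.
  refine ⟨{t ∈ T | 𝓝[T ∩ Ioi t] t = ⊥} ∪ E, union_subset (sep_subset _ _) hET,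
    (countable_setOfPred_isolated_right_within (s := T)).union hEc, fun t ht => ?_⟩
  by_cases h : 𝓝[T ∩ Ioi t] t = ⊥
  · exact subset_closure ⟨Or.inl ⟨ht, h⟩, self_mem_Ici⟩
  · have hcl : t ∈ closure (T ∩ Ioi t) := mem_closure_iff_nhdsWithin_neBot.2 ⟨h⟩
    have hsub : T ∩ Ioi t ⊆ closure (E ∩ Ioi t) := fun s hs =>
      isOpen_Ioi.closure_inter ⟨hTE hs.1, hs.2⟩
    refine closure_mono ?_ (closure_minimal hsub isClosed_closure hcl)
    exact inter_subset_inter subset_union_right Ioi_subset_Ici_self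

/-- A right-continuous process almost surely never visits an open set `U` at a time at which its
marginal law does not charge `U`. -/
theorem ae_forall_notMem_of_measure_eq_zero {Ω : Type*} [MeasurableSpace Ω] (P : Measure Ω)
    (X : ℝ≥0 → Ω → ℝ) (hrc : ∀ᵐ ω ∂P, RightContinuousPath (fun t => X t ω))
    {U : Set ℝ} (hU : IsOpen U) :
    ∀ᵐ ω ∂P, ∀ t, P (X t ⁻¹' U) = 0 → X t ω ∉ U := by
  obtain ⟨D, hDT, hDc, hD⟩ :=
    exists_countable_subset_mem_closure_inter_Ici {t | P (X t ⁻¹' U) = 0}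
  have hDU : ∀ᵐ ω ∂P, ∀ d ∈ D, X d ω ∉ U :=
    (ae_ball_iff hDc).2 fun d hd => measure_eq_zero_iff_ae_notMem.1 (hDT hd)
  filter_upwards [hrc, hDU] with ω hω hωD t ht
  exact hU.isClosed_compl.closure_subset
    (((hω t).mono inter_subset_right).mem_closure (hD t ht) fun d hd => hωD d hd.1)

theorem mainTheorem6 {Ω : Type*} [MeasurableSpace Ω] (P : Measure Ω) [IsProbabilityMeasure P]
    (X : ℝ≥0 → Ω → ℝ) (hX : ∀ t, Measurable (X t))
    (hrc : ∀ᵐ ω ∂P, RightContinuousPath (fun t => X t ω)) :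
    ∀ᵐ ω ∂P, Set.range (fun t : ℝ≥0 => (t, X t ω)) ⊆ marginalSupport P X := by
  have hB := TopologicalSpace.isBasis_countableBasis ℝ
  have key : ∀ᵐ ω ∂P, ∀ U ∈ TopologicalSpace.countableBasis ℝ,
      ∀ t, P (X t ⁻¹' U) = 0 → X t ω ∉ U :=
    (ae_ball_iff (TopologicalSpace.countable_countableBasis ℝ)).2 fun U hU =>
      ae_forall_notMem_of_measure_eq_zero P X hrc (hB.isOpen hU)
  filter_upwards [key] with ω hω
  rintro _ ⟨t, rfl⟩
  by_contra hx
  obtain ⟨V, hV, hV0⟩ := Measure.notMem_support_iff_exists.1 hx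
  obtain ⟨U, hU, hxU, hUV⟩ := hB.mem_nhds_iff.1 hV
  refine hω U hU t ?_ hxU
  rw [← Measure.map_apply (hX t) (hB.isOpen hU).measurableSet]
  exact measure_mono_null hUV hV0
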